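/- **Corollary 7.9.** Let $\Sigma$ be a simplicial complex of dimension $d\ge 0$ on the vertex set $[n]=\{1,\dots,n\}$, that is, a family of subsets of $[n]$ (called faces) that contains $\emptyset$ and is closed under taking subsets, whose largest members have $d+1$ elements. Suppose that $\Sigma$ is *shifted*: whenever $i<j$ in $[n]$ and $F\in\Sigma$ with $i\notin F$, $j\in F$, then $(F\setminus\{j\})\cup\{i\}\in\Sigma$. Write $\Sigma_i$ for the set of faces of $\Sigma$ with $i+1$ elements, and $\deg_{\Sigma_d}(v)=|\{F\in\Sigma_d : v\in F\}|$ (so $\deg_{\Sigma_d}(n+1)=0$). Let $\Bbbk$ be the field of rational functions in indeterminates $x_1,x_2,\dots$ over a field $k$ of characteristic zero; put $X_j=x_j^2$, $E_t=X_1+\dots+X_t$, and $x_F=\prod_{v\in F}x_v$ for finite $F$. In the *coarse weighting*, the top boundary map sends a face $F\in\Sigma_d$ to $$\partial[F]=\sum_{j\in F}\varepsilon(j,F)\,\frac{x_F}{x_{F\setminus\{j\}}}\,[F\setminus\{j\}],$$ where $\varepsilon(j,F)=(-1)^{r+1}$ if $j$ is the $r$-th smallest element of $F$. Let $L=\partial\,\partial^{\mathsf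 T}$ be the coarsely weighted up-down Laplacian, a square matrix over $\Bbbk$ with rows and columns indexed by $\Sigma_{d-1}$. Then: 1. $\deg_{\Sigma_d}(1)\ge\deg_{\Sigma_d}(2)\ge\dots\ge\deg_{\Sigma_d}(n)$, so that the degree sequence is a partition (up to zero entries); its conjugate is the partition in which each $t\in[n]$ occurs with multiplicity $\deg_{\Sigma_d}(t)-\deg_{\Sigma_d}(t+1)$. 2. The characteristic polynomial of $L$ splits into linear factors over $\Bbbk$, and the multiset of the nonzero eigenvalues of $L$ (counted as roots of the characteristic polynomial) is the multiset of the linear forms $E_t$, where $t$ ranges over the parts of this conjugate partition, with multiplicity. 3. (Duval–Reiner) With all weights equal to $1$, the characteristic polynomial of the unweighted up-down Laplacian splits over $k$, and the multiset of its nonzero eigenvalues is the multiset of parts $t$ of this conjugate partition. -/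

import Mathlib

namespace ShiftedLaplacian

open Finset

/-- A simplicial complex on a finite vertex set `V` of natural numbers: a family of subsets of `V`
that contains the empty set and is closed under taking subsets. (An element of `V` need not be a
face by itself.) -/
structure Complex (V : Finset ℕ) where
  faces : Finset (Finset ℕ)
  subset_vertices : ∀ F ∈ faces, F ⊆ V
  empty_mem : ∅ ∈ faces
  down_closed : ∀ F ∈ faces, ∀ G, G ⊆ F → G ∈ faces

namespace Complex

variable {V : Finset ℕ}

/-- The faces with exactly `m` elements, i.e. the faces of dimension `m - 1`. -/
def facesOfCard (S : Complex V) (m : ℕ) : Finset (Finset ℕ) :=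
  S.faces.filter fun F => F.card = m

/-- The complex has dimension `d`: the largest faces have `d + 1` elements. -/
def HasDim (S : Complex V) (d : ℕ) : Prop :=
  (∀ F ∈ S.faces, F.card ≤ d + 1) ∧ ∃ F ∈ S.faces, F.card = d + 1

/-- The complex is shifted: replacing a vertex of a face by a smaller vertex that is not in the
face gives a face again. -/
def IsShifted (S : Complex V) : Prop :=
  ∀ i ∈ V, ∀ j ∈ V, i < j → ∀ F ∈ S.faces, i ∉ F → j ∈ F → insert i (F.erase j) ∈ S.faces

/-- The degree of the vertex `v` in the family of all `d`-dimensional faces. -/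
def deg (S : Complex V) (d v : ℕ) : ℕ :=
  ((S.facesOfCard (d + 1)).filter fun F => v ∈ F).card

end Complex

/-- The position of `v` in `F`: it is `j` if `v` is the `j`-th smallest element of `F`. -/
def position (v : ℕ) (F : Finset ℕ) : ℕ := (F.filter fun u => u ≤ v).card

/-- The incidence sign: `(-1)^(j+1)` if `v` is the `j`-th smallest element of `F`,
and `0` if `v ∉ F`. -/
def eps (R : Type*) [Ring R] (v : ℕ) (F : Finset ℕ) : R :=
  if v ∈ F then (-1) ^ (position v F + 1) else 0

section Weighted

variable {K : Type*} [Field K] {V : Finset ℕ}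

/-- For weights `x i j` and `F = {v₁ < ⋯ < vₘ}`, the monomial `x_{1,v₁} ⋯ x_{m,vₘ}` raised `a`
times, that is `x_{1+a,v₁} ⋯ x_{m+a,vₘ}`. -/
def raisedMonomial (x : ℕ → ℕ → K) (a : ℕ) (F : Finset ℕ) : K :=
  ∏ v ∈ F, x (position v F + a) v

/-- The matrix of the algebraic weighted boundary map from `i`-chains to `(i-1)`-chains of a
complex of dimension `d` (for `i ≤ d`). The column of `F` holds the coefficients of
`∑_{j ∈ F} ε(j,F) * (↑^{d-i} x_F) / (↑^{d-i+1} x_{F∖j}) • [F∖j]`. -/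
def boundary (x : ℕ → ℕ → K) (S : Complex V) (d i : ℕ) :
    Matrix (S.facesOfCard i) (S.facesOfCard (i + 1)) K :=
  Matrix.of fun G F => ∑ j ∈ F.1, if F.1.erase j = G.1 then
    eps K j F.1 * (raisedMonomial x (d - i) F.1 / raisedMonomial x (d - i + 1) (F.1.erase j))
    else 0

/-- The weighted up-down Laplacian on `(i-1)`-chains: the boundary map from `i`-chains after its
transpose, the coboundary map. -/
def upDownLaplacian (x : ℕ → ℕ → K) (S : Complex V) (d i : ℕ) :
    Matrix (S.facesOfCard i) (S.facesOfCard i) K :=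
  boundary x S d i * (boundary x S d i).transpose

/-- The unweighted up-down Laplacian on `(i-1)`-chains: all weights are `1`. -/
def unweightedLaplacian (K : Type*) [Field K] (S : Complex V) (d i : ℕ) :
    Matrix (S.facesOfCard i) (S.facesOfCard i) K :=
  upDownLaplacian (fun _ _ => (1 : K)) S d i

end Weighted

/-- The field of rational functions over `k` in indeterminates `x_j`, `j ∈ ℕ`. -/
abbrev CoarseField (k : Type*) [Field k] : Type _ := FractionRing (MvPolynomial ℕ k)

/-- The indeterminate `x_j`. -/
noncomputable def coarseVar (k : Type*) [Field k] (j : ℕ) : CoarseField k :=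
  algebraMap (MvPolynomial ℕ k) (CoarseField k) (MvPolynomial.X j)

/-- The up-down Laplacian on `(i-1)`-chains in the coarse weighting `x_{i,j} = x_j`. -/
noncomputable def coarseLaplacian (k : Type*) [Field k] {V : Finset ℕ} (S : Complex V) (d i : ℕ) :
    Matrix (S.facesOfCard i) (S.facesOfCard i) (CoarseField k) :=
  upDownLaplacian (fun _ j => coarseVar k j) S d i

/-- The linear form `E_t = X_1 + ⋯ + X_t`, where `X_j = x_j ^ 2`. -/
noncomputable def linearForm (k : Type*) [Field k] (t : ℕ) : CoarseField k :=
  ∑ j ∈ Icc 1 t, coarseVar k j ^ 2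

/-- The conjugate of a partition `lam 1 ≥ lam 2 ≥ ⋯ ≥ lam n`, where `lam (n + 1) = 0`, as a multiset
of parts: each `t` in `[n]` occurs with multiplicity `lam t - lam (t + 1)`. -/
def conjugateParts (n : ℕ) (lam : ℕ → ℕ) : Multiset ℕ :=
  ∑ t ∈ Icc 1 n, Multiset.replicate (lam t - lam (t + 1)) t

open scoped Classical in
/-- The multiset of all eigenvalues of the square matrix `L` over `K` is `A`, up to the
multiplicity of zero: the characteristic polynomial splits over `K` (so there are no other
eigenvalues in an extension field), and its roots are the elements of `A`, with the same
multiplicities except possibly for zero. -/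
def HasEigenvaluesUpToZero {K ι : Type*} [Field K] [Fintype ι] [DecidableEq ι]
    (L : Matrix ι ι K) (A : Multiset K) : Prop :=
  L.charpoly.Splits ∧ L.charpoly.roots.filter (· ≠ 0) = A.filter (· ≠ 0)

end ShiftedLaplacian

/-!
Split a shifted family of finite sets at its least vertex `m` into the link `L` and the deletion
`B` of `m`. Shiftedness gives `∂ B ⊆ L`, so in the basis `L ⊔ B` the down-up Laplacian `∂ᵀ ∂` has
the block form `(x_m² + N, x_m P; x_m Pᵀ, Pᵀ P)`, where `P` is the boundary matrix from `B` to `L`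
and `N` is the down-up Laplacian of `L`. Up to zeros, the eigenvalues of such a matrix are those
of `P Pᵀ + N` shifted by `x_m²`; and as `Pᵀ N = 0`, the eigenvalues of `P Pᵀ + N` are, up to zeros,
those of `Pᵀ P` (the down-up Laplacian of `B`) together with those of `N`. Induction on the least
vertex turns these shifts into the linear forms `E_t`.
-/

namespace ShiftedLaplacian

open Finset Polynomial
open scoped Matrix

section Charpoly

/-- The matrix `(y² + N, y P; y Pᵀ, Pᵀ P)`, which is the shape of the down-up Laplacian of a
near-cone whose apex has weight `y`. -/
def coneMatrix {R α β : Type*} [CommRing R] [Fintype α] [DecidableEq α] (y : R)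
    (P : Matrix α β R) (N : Matrix α α R) : Matrix (α ⊕ β) (α ⊕ β) R :=
  Matrix.fromBlocks (y ^ 2 • 1 + N) (y • P) (y • Pᵀ) (Pᵀ * P)

theorem map_coneMatrix {R R' α β : Type*} [CommRing R] [CommRing R'] [Fintype α] [DecidableEq α]
    (f : R →+* R') (y : R) (P : Matrix α β R) (N : Matrix α α R) :
    (coneMatrix y P N).map f = coneMatrix (f y) (P.map f) (N.map f) := by
  ext (i | i) (j | j)
  all_goals simp [coneMatrix, Matrix.mul_apply, Matrix.one_apply, apply_ite f]

theorem map_C_map_evalRingHom {R α β : Type*} [CommRing R] (y : R) (Q : Matrix α β R) :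
    (Q.map C).map (evalRingHom y) = Q := by
  ext
  simp

variable {R α β : Type*} [CommRing R] [Fintype α] [DecidableEq α] [Fintype β] [DecidableEq β]

theorem X_pow_mul_charpoly_add {U V : Matrix α α R} (h : U * V = 0) :
    X ^ Fintype.card α * (U + V).charpoly = U.charpoly * V.charpoly := by
  have hUV : U.map C * V.map C = 0 := by rw [← Matrix.map_mul, h, Matrix.map_zero _ C_0]
  have hcomm : U.map C * Matrix.scalar α X = Matrix.scalar α X * U.map C :=
    (Matrix.scalar_commute (X : R[X]) (fun _ => Commute.all _ _) (U.map C)).eq.symm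
  have hchar : Matrix.scalar α X * (U + V).charmatrix = U.charmatrix * V.charmatrix := by
    simp only [Matrix.charmatrix, RingHom.mapMatrix_apply, sub_mul, mul_sub, hUV, hcomm,
      Matrix.map_add C (fun _ _ => C_add), mul_add]
    abel
  simpa [Matrix.charpoly] using congrArg Matrix.det hchar

theorem isLeftRegular_C {a : R} (ha : IsLeftRegular a) : IsLeftRegular (C a) := fun p q h => by
  ext i
  exact ha (by simpa using congrArg (coeff · i) h)

theorem charpoly_eq_of_mul_eq_mul {M T S : Matrix α α R} (h : M * S = S * T)
    (hS : IsLeftRegular S.det) : M.charpoly = T.charpoly := by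
  have hcomm : Matrix.scalar α X * S.map C = S.map C * Matrix.scalar α X :=
    (Matrix.scalar_commute (X : R[X]) (fun _ => Commute.all _ _) (S.map C)).eq
  have hchar : M.charmatrix * S.map C = S.map C * T.charmatrix := by
    simp only [Matrix.charmatrix, RingHom.mapMatrix_apply, sub_mul, mul_sub, hcomm,
      ← Matrix.map_mul, h]
  have hdet : (S.map C).det = C S.det := (RingHom.map_det C S).symm
  apply isLeftRegular_C hS
  simpa [Matrix.charpoly, hdet, mul_comm] using congrArg Matrix.det hchar

theorem charpoly_smul_one_add (c : R) (M : Matrix α α R) :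
    (c • 1 + M).charpoly = M.charpoly.comp (X - C c) := by
  rw [sub_eq_add_neg, ← C_neg, ← Matrix.charpoly_sub_scalar, map_neg, sub_neg_eq_add, add_comm,
    Matrix.scalar_apply, Matrix.smul_one_eq_diagonal]

theorem charpoly_coneMatrix_of_isLeftRegular {y : R} (hy : IsLeftRegular y) {P : Matrix α β R}
    {N : Matrix α α R} (hN : Pᵀ * N = 0) :
    (coneMatrix y P N).charpoly =
      X ^ Fintype.card β * (P * Pᵀ + N).charpoly.comp (X - C (y ^ 2)) := by
  let S : Matrix (α ⊕ β) (α ⊕ β) R := Matrix.fromBlocks (y • 1) 0 Pᵀ 1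
  let T : Matrix (α ⊕ β) (α ⊕ β) R := Matrix.fromBlocks (y ^ 2 • 1 + (P * Pᵀ + N)) P 0 0
  have hintertwine : coneMatrix y P N * S = S * T := by
    simp only [coneMatrix, S, T, Matrix.fromBlocks_multiply, Matrix.mul_add,
      Matrix.mul_smul, Matrix.smul_mul, Matrix.mul_one, Matrix.one_mul, Matrix.mul_zero,
      hN, smul_add, smul_smul, Matrix.mul_assoc, add_zero, zero_add, ← sq,
      ← pow_succ, ← pow_succ']
    congr 1
    abel
  have hdet : IsLeftRegular S.det := by
    simpa [S] using hy.pow (Fintype.card α)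
  rw [charpoly_eq_of_mul_eq_mul hintertwine hdet, Matrix.charpoly_fromBlocks_zero₂₁,
    charpoly_smul_one_add, Matrix.charpoly_zero, mul_comm]

theorem charpoly_coneMatrix (y : R) {P : Matrix α β R} {N : Matrix α α R} (hN : Pᵀ * N = 0) :
    (coneMatrix y P N).charpoly =
      X ^ Fintype.card β * (P * Pᵀ + N).charpoly.comp (X - C (y ^ 2)) := by
  -- Both sides are specializations of the same expressions with `y` an indeterminate.
  have hNC : (P.map C)ᵀ * N.map C = 0 := by
    rw [← Matrix.transpose_map, ← Matrix.map_mul, hN, Matrix.map_zero _ C_0]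
  have hgeneric := congrArg (Polynomial.map (evalRingHom y))
    (charpoly_coneMatrix_of_isLeftRegular (isRegular_X (R := R)).left hNC)
  have hsum : P.map C * (P.map C)ᵀ + N.map C = (P * Pᵀ + N).map C := by
    rw [Matrix.map_add C (fun _ _ => C_add), Matrix.map_mul, Matrix.transpose_map]
  rw [← Matrix.charpoly_map, map_coneMatrix, map_C_map_evalRingHom, map_C_map_evalRingHom,
    Polynomial.map_mul, map_comp, hsum, ← Matrix.charpoly_map, map_C_map_evalRingHom] at hgeneric
  simpa using hgeneric

end Charpoly

section Boundary

variable {R : Type*} [CommRing R]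

/-- The matrix of the boundary map `[F] ↦ ∑ j ∈ F, ε(j,F) x_j [F∖j]` of the full simplex on `ℕ`;
the columns are indexed by `F`. -/
def simplexBoundary (x : ℕ → R) : Matrix (Finset ℕ) (Finset ℕ) R :=
  Matrix.of fun G F => ∑ j ∈ F, if F.erase j = G then eps R j F * x j else 0

/-- The matrix of the down-up Laplacian `∂ᵀ ∂` of the full simplex on `ℕ`. The sum over all rows of
`∂` is written as a sum over the rows `F∖j` that contribute. -/
def simplexDownUp (x : ℕ → R) : Matrix (Finset ℕ) (Finset ℕ) R :=
  Matrix.of fun F F' => ∑ j ∈ F, eps R j F * x j * simplexBoundary x (F.erase j) F'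

/-- The boundary map from the chains on `𝒜` to the chains on `𝒢`. -/
def boundaryMatrix (x : ℕ → R) (𝒢 𝒜 : Finset (Finset ℕ)) : Matrix 𝒢 𝒜 R :=
  (simplexBoundary x).submatrix (↑) (↑)

/-- The down-up Laplacian `∂ᵀ ∂` on the chains on a family `𝒜` of finite sets; the boundaries are
taken in the full simplex, so no closure condition on `𝒜` is involved. -/
def downUpLaplacian (x : ℕ → R) (𝒜 : Finset (Finset ℕ)) : Matrix 𝒜 𝒜 R :=
  (simplexDownUp x).submatrix (↑) (↑)

theorem position_erase_of_lt {F : Finset ℕ} {i j : ℕ} (h : i < j) :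
    position i (F.erase j) = position i F := by
  rw [position, filter_erase, erase_eq_of_notMem, position]
  simp [h]

theorem position_erase_add_one {F : Finset ℕ} {i j : ℕ} (hj : j ∈ F) (h : j < i) :
    position i (F.erase j) + 1 = position i F := by
  rw [position, filter_erase, card_erase_add_one, position]
  simp [hj, h.le]

theorem eps_erase_of_lt {F : Finset ℕ} {i j : ℕ} (h : i < j) :
    eps R i (F.erase j) = eps R i F := by
  simp [eps, position_erase_of_lt h, h.ne]

theorem eps_erase_of_gt {F : Finset ℕ} {i j : ℕ} (hj : j ∈ F) (h : j < i) :
    eps R i (F.erase j) = -eps R i F := by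
  simp only [eps, ← position_erase_add_one hj h, mem_erase, h.ne', ne_eq, not_false_eq_true,
    true_and]
  split_ifs <;> ring

theorem eps_insert_self {m : ℕ} {F : Finset ℕ} (hF : ∀ v ∈ F, m < v) :
    eps R m (insert m F) = 1 := by
  have hfilter : F.filter (· ≤ m) = ∅ := filter_eq_empty_iff.2 fun v hv => (hF v hv).not_ge
  simp [eps, position, filter_insert, hfilter]

theorem eps_insert_of_lt {m j : ℕ} {F : Finset ℕ} (hm : m ∉ F) (h : m < j) :
    eps R j (insert m F) = -eps R j F := by
  have herase := eps_erase_of_gt (R := R) (mem_insert_self m F) h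
  rw [erase_insert hm] at herase
  rw [herase, neg_neg]

theorem eps_erase_mul_eps {F : Finset ℕ} {i j : ℕ} (hi : i ∈ F) (hj : j ∈ F) (h : i ≠ j) :
    eps R i (F.erase j) * eps R j F = -(eps R j (F.erase i) * eps R i F) := by
  rcases h.lt_or_gt with h | h
  · rw [eps_erase_of_lt h, eps_erase_of_gt hi h]
    ring
  · rw [eps_erase_of_lt h, eps_erase_of_gt hj h]
    ring

theorem sum_mul_simplexBoundary (x : ℕ → R) {𝒢 : Finset (Finset ℕ)} {F : Finset ℕ}
    (h : ∀ j ∈ F, F.erase j ∈ 𝒢) (a : Finset ℕ → R) :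
    ∑ G ∈ 𝒢, a G * simplexBoundary x G F = ∑ j ∈ F, eps R j F * x j * a (F.erase j) := by
  simp only [simplexBoundary, Matrix.of_apply, mul_sum, mul_ite, mul_zero]
  rw [sum_comm]
  refine sum_congr rfl fun j hj => ?_
  rw [sum_ite_eq, if_pos (h j hj), mul_comm]

theorem sum_simplexBoundary_erase_eq_zero (x : ℕ → R) (H F : Finset ℕ) :
    ∑ j ∈ F, eps R j F * x j * simplexBoundary x H (F.erase j) = 0 := by
  simp only [simplexBoundary, Matrix.of_apply, mul_sum]
  rw [sum_sigma']
  -- Deleting `j` and then `i` cancels against deleting `i` and then `j`.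
  refine sum_involution (fun p _ => ⟨p.2, p.1⟩) ?_ ?_ ?_ fun _ _ => rfl
  · rintro ⟨j, i⟩ hp
    obtain ⟨hj, hij, hi⟩ : j ∈ F ∧ i ≠ j ∧ i ∈ F := by simpa using hp
    simp only [erase_right_comm (a := i) (b := j)]
    split_ifs
    · linear_combination x i * x j * eps_erase_mul_eps (R := R) hi hj hij
    · simp
  · rintro ⟨j, i⟩ hp _ heq
    simp only [mem_sigma, mem_erase] at hp
    exact hp.2.1 (congrArg Sigma.fst heq)
  · rintro ⟨j, i⟩ hp
    simp only [mem_sigma, mem_erase] at hp ⊢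
    exact ⟨hp.2.2, hp.2.1.symm, hp.1⟩

theorem boundaryMatrix_mul_boundaryMatrix (x : ℕ → R) (ℋ : Finset (Finset ℕ))
    {𝒢 𝒜 : Finset (Finset ℕ)} (h : 𝒜.shadow ⊆ 𝒢) :
    boundaryMatrix x ℋ 𝒢 * boundaryMatrix x 𝒢 𝒜 = 0 := by
  ext H F
  simp only [Matrix.mul_apply, boundaryMatrix, Matrix.submatrix_apply, Matrix.zero_apply]
  rw [sum_coe_sort 𝒢 fun G => simplexBoundary x H G * simplexBoundary x G F,
    sum_mul_simplexBoundary x fun j hj => h (erase_mem_shadow F.2 hj),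
    sum_simplexBoundary_erase_eq_zero]

theorem transpose_boundaryMatrix_mul_self (x : ℕ → R) {𝒢 𝒜 : Finset (Finset ℕ)}
    (h : 𝒜.shadow ⊆ 𝒢) :
    (boundaryMatrix x 𝒢 𝒜)ᵀ * boundaryMatrix x 𝒢 𝒜 = downUpLaplacian x 𝒜 := by
  ext F F'
  simp only [Matrix.mul_apply, Matrix.transpose_apply, boundaryMatrix, downUpLaplacian,
    Matrix.submatrix_apply, simplexDownUp, Matrix.of_apply]
  rw [sum_coe_sort 𝒢 fun G => simplexBoundary x G F * simplexBoundary x G F',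
    ← sum_mul_simplexBoundary x (fun j hj => h (erase_mem_shadow F.2 hj))
      fun G => simplexBoundary x G F']
  exact sum_congr rfl fun G _ => mul_comm _ _

end Boundary

section Cone

variable {R : Type*} [CommRing R]

theorem simplexBoundary_insert_right (x : ℕ → R) {m : ℕ} {F G : Finset ℕ}
    (hF : ∀ v ∈ F, m < v) (hG : m ∉ G) :
    simplexBoundary x G (insert m F) = if G = F then x m else 0 := by
  have hm : m ∉ F := fun h => (hF m h).false
  have hother : ∀ j ∈ F, (insert m F).erase j ≠ G := fun j hj h =>
    hG (h ▸ mem_erase.2 ⟨(hF j hj).ne, mem_insert_self m F⟩)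
  rw [simplexBoundary, Matrix.of_apply, sum_insert hm, erase_insert hm, eps_insert_self hF,
    one_mul, sum_eq_zero fun j hj => if_neg (hother j hj), add_zero]
  simp only [eq_comm (a := F)]

theorem simplexBoundary_insert_left (x : ℕ → R) {m : ℕ} {F : Finset ℕ} (hm : m ∉ F)
    (G : Finset ℕ) : simplexBoundary x (insert m G) F = 0 :=
  sum_eq_zero fun _ _ => if_neg fun h => hm (mem_of_mem_erase (h ▸ mem_insert_self m G))

theorem simplexBoundary_insert_insert (x : ℕ → R) {m : ℕ} {F G : Finset ℕ}
    (hF : ∀ v ∈ F, m < v) (hG : m ∉ G) :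
    simplexBoundary x (insert m G) (insert m F) = -simplexBoundary x G F := by
  have hm : m ∉ F := fun h => (hF m h).false
  have hne : F ≠ insert m G := fun h => hm (h ▸ mem_insert_self m G)
  rw [simplexBoundary, Matrix.of_apply, Matrix.of_apply, sum_insert hm, erase_insert hm,
    if_neg hne, zero_add, ← sum_neg_distrib]
  refine sum_congr rfl fun j hj => ?_
  have hiff : insert m (F.erase j) = insert m G ↔ F.erase j = G :=
    insert_erase_invOn.2.injOn.eq_iff (fun h => hm (mem_of_mem_erase h)) hG
  rw [erase_insert_of_ne (hF j hj).ne, eps_insert_of_lt hm (hF j hj)]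
  simp only [hiff]
  split_ifs <;> ring

theorem simplexDownUp_insert_left (x : ℕ → R) {m : ℕ} {F : Finset ℕ} (hF : ∀ v ∈ F, m < v)
    (F' : Finset ℕ) :
    simplexDownUp x (insert m F) F' = x m * simplexBoundary x F F' -
      ∑ j ∈ F, eps R j F * x j * simplexBoundary x (insert m (F.erase j)) F' := by
  have hm : m ∉ F := fun h => (hF m h).false
  rw [simplexDownUp, Matrix.of_apply, sum_insert hm, erase_insert hm, eps_insert_self hF, one_mul,
    sub_eq_add_neg, ← sum_neg_distrib]
  congr 1
  refine sum_congr rfl fun j hj => ?_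
  rw [erase_insert_of_ne (hF j hj).ne, eps_insert_of_lt hm (hF j hj), neg_mul, neg_mul]

theorem simplexDownUp_insert_insert (x : ℕ → R) {m : ℕ} {F F' : Finset ℕ}
    (hF : ∀ v ∈ F, m < v) (hF' : ∀ v ∈ F', m < v) :
    simplexDownUp x (insert m F) (insert m F') =
      (if F = F' then x m ^ 2 else 0) + simplexDownUp x F F' := by
  have hm : m ∉ F := fun h => (hF m h).false
  have hsum : ∑ j ∈ F, eps R j F * x j * simplexBoundary x (insert m (F.erase j)) (insert m F') =
      -simplexDownUp x F F' := by
    rw [simplexDownUp, Matrix.of_apply, ← sum_neg_distrib]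
    refine sum_congr rfl fun j _ => ?_
    rw [simplexBoundary_insert_insert x hF' fun h => hm (mem_of_mem_erase h), mul_neg]
  rw [simplexDownUp_insert_left x hF, simplexBoundary_insert_right x hF' hm, hsum,
    sub_neg_eq_add, mul_ite, mul_zero, ← sq]

theorem simplexDownUp_insert_of_notMem (x : ℕ → R) {m : ℕ} {F F' : Finset ℕ}
    (hF : ∀ v ∈ F, m < v) (hm : m ∉ F') :
    simplexDownUp x (insert m F) F' = x m * simplexBoundary x F F' := by
  simp only [simplexDownUp_insert_left x hF, simplexBoundary_insert_left x hm, mul_zero,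
    sum_const_zero, sub_zero]

theorem simplexDownUp_of_notMem_insert (x : ℕ → R) {m : ℕ} {F F' : Finset ℕ}
    (hF' : ∀ v ∈ F', m < v) (hm : m ∉ F) :
    simplexDownUp x F (insert m F') = x m * simplexBoundary x F' F := by
  rw [simplexDownUp, simplexBoundary, Matrix.of_apply, Matrix.of_apply, mul_sum]
  refine sum_congr rfl fun j _ => ?_
  rw [← simplexBoundary, simplexBoundary_insert_right x hF' fun h => hm (mem_of_mem_erase h)]
  split_ifs <;> ring

/-- A family of finite sets is the disjoint union of the cone with apex `m` over its link at `m`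
and of its deletion of `m`. -/
def linkSumDeletionEquiv (m : ℕ) (𝒜 : Finset (Finset ℕ)) :
    𝒜.memberSubfamily m ⊕ 𝒜.nonMemberSubfamily m ≃ 𝒜 where
  toFun := Sum.elim (fun F => ⟨insert m F, (mem_memberSubfamily.1 F.2).1⟩)
    fun F => ⟨F, (mem_nonMemberSubfamily.1 F.2).1⟩
  invFun F :=
    if h : m ∈ F.1 then
      Sum.inl ⟨F.1.erase m, mem_memberSubfamily.2
        ⟨(insert_erase h).symm ▸ F.2, notMem_erase m F⟩⟩
    else Sum.inr ⟨F, mem_nonMemberSubfamily.2 ⟨F.2, h⟩⟩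
  left_inv := by
    rintro (⟨F, hF⟩ | ⟨F, hF⟩)
    · simp [erase_insert (mem_memberSubfamily.1 hF).2]
    · simp [(mem_nonMemberSubfamily.1 hF).2]
  right_inv := by
    rintro ⟨F, hF⟩
    by_cases h : m ∈ F <;> simp [h]

theorem downUpLaplacian_submatrix_eq_coneMatrix (x : ℕ → R) {m : ℕ} {𝒜 : Finset (Finset ℕ)}
    (hm : ∀ F ∈ 𝒜, ∀ v ∈ F, m ≤ v)
    (hshadow : (𝒜.nonMemberSubfamily m).shadow ⊆ 𝒜.memberSubfamily m) :
    (downUpLaplacian x 𝒜).submatrix (linkSumDeletionEquiv m 𝒜) (linkSumDeletionEquiv m 𝒜) =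
      coneMatrix (x m) (boundaryMatrix x (𝒜.memberSubfamily m) (𝒜.nonMemberSubfamily m))
        (downUpLaplacian x (𝒜.memberSubfamily m)) := by
  have hlink : ∀ F ∈ 𝒜.memberSubfamily m, ∀ v ∈ F, m < v := fun F hF v hv => by
    obtain ⟨hF, hmF⟩ := mem_memberSubfamily.1 hF
    exact (hm _ hF v (mem_insert_of_mem hv)).lt_of_ne fun h => hmF (h ▸ hv)
  have hdel : ∀ F ∈ 𝒜.nonMemberSubfamily m, m ∉ F := fun F hF => (mem_nonMemberSubfamily.1 hF).2
  rw [coneMatrix, transpose_boundaryMatrix_mul_self x hshadow]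
  ext (⟨F, hF⟩ | ⟨F, hF⟩) (⟨F', hF'⟩ | ⟨F', hF'⟩)
  · simp [linkSumDeletionEquiv, downUpLaplacian, Matrix.one_apply,
      simplexDownUp_insert_insert x (hlink F hF) (hlink F' hF')]
  · simp [linkSumDeletionEquiv, downUpLaplacian, boundaryMatrix,
      simplexDownUp_insert_of_notMem x (hlink F hF) (hdel F' hF')]
  · simp [linkSumDeletionEquiv, downUpLaplacian, boundaryMatrix,
      simplexDownUp_of_notMem_insert x (hlink F' hF') (hdel F hF)]
  · simp [linkSumDeletionEquiv, downUpLaplacian]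

theorem X_sub_C_pow_mul_charpoly_downUpLaplacian (x : ℕ → R) {m : ℕ} {𝒜 : Finset (Finset ℕ)}
    (hm : ∀ F ∈ 𝒜, ∀ v ∈ F, m ≤ v)
    (hshadow : (𝒜.nonMemberSubfamily m).shadow ⊆ 𝒜.memberSubfamily m) :
    (X - C (x m ^ 2)) ^ #(𝒜.nonMemberSubfamily m) * (downUpLaplacian x 𝒜).charpoly =
      X ^ #(𝒜.nonMemberSubfamily m) *
        ((downUpLaplacian x (𝒜.memberSubfamily m)).charpoly *
          (downUpLaplacian x (𝒜.nonMemberSubfamily m)).charpoly).comp (X - C (x m ^ 2)) := by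
  set L := 𝒜.memberSubfamily m
  set B := 𝒜.nonMemberSubfamily m
  let P := boundaryMatrix x L B
  have hPN : Pᵀ * downUpLaplacian x L = 0 := by
    rw [← transpose_boundaryMatrix_mul_self x (subset_refl L.shadow), ← Matrix.mul_assoc,
      ← Matrix.transpose_mul, boundaryMatrix_mul_boundaryMatrix x _ hshadow,
      Matrix.transpose_zero, Matrix.zero_mul]
  have hcone : (downUpLaplacian x 𝒜).charpoly =
      X ^ #B * (P * Pᵀ + downUpLaplacian x L).charpoly.comp (X - C (x m ^ 2)) := by
    rw [← Matrix.charpoly_reindex (linkSumDeletionEquiv m 𝒜).symm, Matrix.reindex_apply,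
      Equiv.symm_symm, downUpLaplacian_submatrix_eq_coneMatrix x hm hshadow,
      charpoly_coneMatrix (x m) hPN, Fintype.card_coe]
  have hadd : X ^ #L * (P * Pᵀ + downUpLaplacian x L).charpoly =
      (P * Pᵀ).charpoly * (downUpLaplacian x L).charpoly := by
    rw [← Fintype.card_coe L]
    exact X_pow_mul_charpoly_add (by rw [Matrix.mul_assoc, hPN, Matrix.mul_zero])
  have hswap : X ^ #B * (P * Pᵀ).charpoly = X ^ #L * (downUpLaplacian x B).charpoly := by
    rw [← transpose_boundaryMatrix_mul_self x hshadow]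
    simpa only [Fintype.card_coe] using Matrix.charpoly_mul_comm' P Pᵀ
  have hsplit : X ^ #B * (P * Pᵀ + downUpLaplacian x L).charpoly =
      (downUpLaplacian x L).charpoly * (downUpLaplacian x B).charpoly := by
    apply (isRegular_X_pow (R := R) #L).left
    linear_combination X ^ #B * hadd + (downUpLaplacian x L).charpoly * hswap
  rw [hcone, ← hsplit, mul_comp, X_pow_comp]
  ring

end Cone

section Shifted

/-- The number of members of `𝒜` that contain `v`. -/
def vertexDegree (𝒜 : Finset (Finset ℕ)) (v : ℕ) : ℕ := #{F ∈ 𝒜 | v ∈ F}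

/-- A family of subsets of `{m, …, n}` is shifted if it is closed under replacing an element of a
member by a smaller one. The member is written as `insert j G` and its replacement as
`insert i G`. -/
structure IsShiftedFamily (m n : ℕ) (𝒜 : Finset (Finset ℕ)) : Prop where
  subset_Icc : ∀ F ∈ 𝒜, F ⊆ Icc m n
  insert_mem : ∀ i j G, m ≤ i → i < j → i ∉ G → j ∉ G → insert j G ∈ 𝒜 → insert i G ∈ 𝒜

theorem card_memberSubfamily (𝒜 : Finset (Finset ℕ)) (v : ℕ) :
    #(𝒜.memberSubfamily v) = vertexDegree 𝒜 v := by
  have hsplit : vertexDegree 𝒜 v + #(𝒜.nonMemberSubfamily v) = #𝒜 :=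
    card_filter_add_card_filter_not _
  have hcard := card_memberSubfamily_add_card_nonMemberSubfamily v 𝒜
  omega

theorem vertexDegree_add_card_nonMemberSubfamily (𝒜 : Finset (Finset ℕ)) (v : ℕ) :
    vertexDegree 𝒜 v + #(𝒜.nonMemberSubfamily v) = #𝒜 := by
  rw [← card_memberSubfamily, card_memberSubfamily_add_card_nonMemberSubfamily]

theorem memberSubfamily_comm (𝒜 : Finset (Finset ℕ)) (v w : ℕ) :
    (𝒜.memberSubfamily v).memberSubfamily w = (𝒜.memberSubfamily w).memberSubfamily v := by
  ext F
  simp only [mem_memberSubfamily, mem_insert, not_or, insert_comm v w F, eq_comm (a := v)]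
  tauto

theorem vertexDegree_memberSubfamily_add (𝒜 : Finset (Finset ℕ)) {m t : ℕ} (h : t ≠ m) :
    vertexDegree (𝒜.memberSubfamily m) t + vertexDegree (𝒜.nonMemberSubfamily m) t =
      vertexDegree 𝒜 t := by
  have hdel : (𝒜.nonMemberSubfamily m).memberSubfamily t =
      (𝒜.memberSubfamily t).nonMemberSubfamily m := by
    ext F
    simp only [mem_memberSubfamily, mem_nonMemberSubfamily, mem_insert, h.symm, false_or]
    tauto
  simp only [← card_memberSubfamily, memberSubfamily_comm 𝒜 m t, hdel,
    card_memberSubfamily_add_card_nonMemberSubfamily]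

namespace IsShiftedFamily

variable {m n : ℕ} {𝒜 : Finset (Finset ℕ)}

theorem vertexDegree_le (h : IsShiftedFamily m n 𝒜) {v w : ℕ} (hv : m ≤ v) (hvw : v ≤ w) :
    vertexDegree 𝒜 w ≤ vertexDegree 𝒜 v := by
  obtain rfl | hlt := hvw.eq_or_lt
  · rfl
  have hreplace : (𝒜.memberSubfamily w).nonMemberSubfamily v ⊆
      (𝒜.memberSubfamily v).nonMemberSubfamily w := fun G hG => by
    simp only [mem_nonMemberSubfamily, mem_memberSubfamily] at hG ⊢
    obtain ⟨⟨hG, hwG⟩, hvG⟩ := hG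
    exact ⟨⟨h.insert_mem v w G hv hlt hvG hwG hG, hvG⟩, hwG⟩
  calc vertexDegree 𝒜 w
      = #((𝒜.memberSubfamily w).memberSubfamily v) +
          #((𝒜.memberSubfamily w).nonMemberSubfamily v) := by
        rw [card_memberSubfamily_add_card_nonMemberSubfamily, card_memberSubfamily]
    _ ≤ #((𝒜.memberSubfamily v).memberSubfamily w) +
          #((𝒜.memberSubfamily v).nonMemberSubfamily w) := by
        rw [memberSubfamily_comm]
        gcongr
    _ = vertexDegree 𝒜 v := by
        rw [card_memberSubfamily_add_card_nonMemberSubfamily, card_memberSubfamily]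

theorem memberSubfamily (h : IsShiftedFamily m n 𝒜) :
    IsShiftedFamily (m + 1) n (𝒜.memberSubfamily m) where
  subset_Icc F hF v hv := by
    obtain ⟨hF, hm⟩ := mem_memberSubfamily.1 hF
    have hmv : m ≠ v := fun hmv => hm (hmv ▸ hv)
    have hvIcc := mem_Icc.1 (h.subset_Icc _ hF (mem_insert_of_mem hv))
    exact mem_Icc.2 (by omega)
  insert_mem i j G hi hij hiG hjG hG := by
    simp only [mem_memberSubfamily, mem_insert, not_or] at hG ⊢
    obtain ⟨hG, -, hmG⟩ := hG
    rw [insert_comm] at hG ⊢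
    refine ⟨h.insert_mem i j _ (by omega) hij ?_ ?_ hG, by omega, hmG⟩
    · simp only [mem_insert, not_or]
      exact ⟨by omega, hiG⟩
    · simp only [mem_insert, not_or]
      exact ⟨by omega, hjG⟩

theorem nonMemberSubfamily (h : IsShiftedFamily m n 𝒜) :
    IsShiftedFamily (m + 1) n (𝒜.nonMemberSubfamily m) where
  subset_Icc F hF v hv := by
    obtain ⟨hF, hm⟩ := mem_nonMemberSubfamily.1 hF
    have hmv : m ≠ v := fun hmv => hm (hmv ▸ hv)
    have hvIcc := mem_Icc.1 (h.subset_Icc F hF hv)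
    exact mem_Icc.2 (by omega)
  insert_mem i j G hi hij hiG hjG hG := by
    simp only [mem_nonMemberSubfamily, mem_insert, not_or] at hG ⊢
    obtain ⟨hG, -, hmG⟩ := hG
    exact ⟨h.insert_mem i j G (by omega) hij hiG hjG hG, by omega, hmG⟩

theorem shadow_nonMemberSubfamily_subset (h : IsShiftedFamily m n 𝒜) :
    (𝒜.nonMemberSubfamily m).shadow ⊆ 𝒜.memberSubfamily m := fun G hG => by
  obtain ⟨j, hjG, hj⟩ := mem_shadow_iff_insert_mem.1 hG
  have hmj := mem_Icc.1 (h.nonMemberSubfamily.subset_Icc _ hj (mem_insert_self j G))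
  obtain ⟨hj, hm⟩ := mem_nonMemberSubfamily.1 hj
  have hmG : m ∉ G := fun hmem => hm (mem_insert_of_mem hmem)
  exact mem_memberSubfamily.2 ⟨h.insert_mem m j G le_rfl (by omega) hmG hjG hj, hmG⟩

theorem card_nonMemberSubfamily_add (h : IsShiftedFamily m n 𝒜) :
    #((𝒜.memberSubfamily m).nonMemberSubfamily (m + 1)) +
        #((𝒜.nonMemberSubfamily m).nonMemberSubfamily (m + 1)) =
      #(𝒜.nonMemberSubfamily m) + (vertexDegree 𝒜 m - vertexDegree 𝒜 (m + 1)) := by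
  have hlink := vertexDegree_add_card_nonMemberSubfamily (𝒜.memberSubfamily m) (m + 1)
  have hdel := vertexDegree_add_card_nonMemberSubfamily (𝒜.nonMemberSubfamily m) (m + 1)
  have hdegree := vertexDegree_memberSubfamily_add 𝒜 m.lt_add_one.ne'
  have hle := h.vertexDegree_le le_rfl (Nat.le_add_right m 1)
  have hcard := card_memberSubfamily 𝒜 m
  omega

end IsShiftedFamily

end Shifted

section ShiftedCharpoly

variable {R : Type*} [CommRing R]

/-- The monic polynomial whose roots are the sums `x_m² + ⋯ + x_t²` for `t ∈ {m, …, n}`, with the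
multiplicities `δ t - δ (t + 1)` of the parts of the conjugate of the partition `δ`. -/
noncomputable def conjugatePolynomial (x : ℕ → R) (m n : ℕ) (δ : ℕ → ℕ) : R[X] :=
  ∏ t ∈ Icc m n, (X - C (∑ j ∈ Icc m t, x j ^ 2)) ^ (δ t - δ (t + 1))

theorem conjugatePolynomial_mul (x : ℕ → R) {m n : ℕ} {δ δ₁ δ₂ : ℕ → ℕ}
    (hδ : ∀ t, m ≤ t → δ₁ t + δ₂ t = δ t) (h₁ : ∀ t, m ≤ t → δ₁ (t + 1) ≤ δ₁ t)
    (h₂ : ∀ t, m ≤ t → δ₂ (t + 1) ≤ δ₂ t) :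
    conjugatePolynomial x m n δ₁ * conjugatePolynomial x m n δ₂ = conjugatePolynomial x m n δ := by
  rw [conjugatePolynomial, conjugatePolynomial, ← prod_mul_distrib]
  refine prod_congr rfl fun t ht => ?_
  have hmt := (mem_Icc.1 ht).1
  rw [← pow_add, ← hδ t hmt, ← hδ (t + 1) (by omega)]
  have h₁t := h₁ t hmt
  have h₂t := h₂ t hmt
  congr 1
  omega

theorem conjugatePolynomial_of_le (x : ℕ → R) {m n : ℕ} (hmn : m ≤ n) (δ : ℕ → ℕ) :
    conjugatePolynomial x m n δ = (X - C (x m ^ 2)) ^ (δ m - δ (m + 1)) *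
      (conjugatePolynomial x (m + 1) n δ).comp (X - C (x m ^ 2)) := by
  rw [conjugatePolynomial, conjugatePolynomial, Polynomial.prod_comp,
    ← insert_Icc_add_one_left_eq_Icc hmn, prod_insert (by simp), Icc_self, sum_singleton]
  congr 1
  refine prod_congr rfl fun t ht => ?_
  have hmt : m ≤ t := (Nat.le_succ m).trans (mem_Icc.1 ht).1
  rw [← insert_Icc_add_one_left_eq_Icc hmt, sum_insert (by simp), pow_comp, sub_comp, X_comp,
    C_comp, C_add, sub_sub]

theorem IsShiftedFamily.conjugatePolynomial_mul {m n : ℕ} {𝒜 : Finset (Finset ℕ)}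
    (h : IsShiftedFamily m n 𝒜) (x : ℕ → R) :
    conjugatePolynomial x (m + 1) n (vertexDegree (𝒜.memberSubfamily m)) *
        conjugatePolynomial x (m + 1) n (vertexDegree (𝒜.nonMemberSubfamily m)) =
      conjugatePolynomial x (m + 1) n (vertexDegree 𝒜) :=
  ShiftedLaplacian.conjugatePolynomial_mul x
    (fun _ ht => vertexDegree_memberSubfamily_add 𝒜 (Nat.lt_of_succ_le ht).ne')
    (fun t ht => h.memberSubfamily.vertexDegree_le ht t.le_succ)
    fun t ht => h.nonMemberSubfamily.vertexDegree_le ht t.le_succ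

theorem charpoly_downUpLaplacian_of_forall_eq_empty (x : ℕ → R) {𝒜 : Finset (Finset ℕ)}
    (h : ∀ F ∈ 𝒜, F = ∅) : (downUpLaplacian x 𝒜).charpoly = X ^ #𝒜 := by
  have hzero : downUpLaplacian x 𝒜 = 0 := by
    ext F F'
    simp [downUpLaplacian, simplexDownUp, h F F.2]
  rw [hzero, Matrix.charpoly_zero, Fintype.card_coe]

theorem IsShiftedFamily.charpoly_downUpLaplacian {m n : ℕ} {𝒜 : Finset (Finset ℕ)}
    (h : IsShiftedFamily m n 𝒜) (x : ℕ → R) :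
    (downUpLaplacian x 𝒜).charpoly =
      X ^ #(𝒜.nonMemberSubfamily m) * conjugatePolynomial x m n (vertexDegree 𝒜) := by
  induction hk : n + 1 - m generalizing m 𝒜 with
  | zero =>
    have hIcc : Icc m n = ∅ := Icc_eq_empty_of_lt (by omega)
    have hempty : ∀ F ∈ 𝒜, F = ∅ := fun F hF => subset_empty.1 (hIcc ▸ h.subset_Icc F hF)
    have hdel : 𝒜.nonMemberSubfamily m = 𝒜 :=
      filter_true_of_mem fun F hF => hempty F hF ▸ notMem_empty m
    rw [charpoly_downUpLaplacian_of_forall_eq_empty x hempty, hdel, conjugatePolynomial, hIcc,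
      prod_empty, mul_one]
  | succ k ih =>
    have ihL := ih h.memberSubfamily (by omega)
    have ihB := ih h.nonMemberSubfamily (by omega)
    have hcone := X_sub_C_pow_mul_charpoly_downUpLaplacian x
      (fun F hF v hv => (mem_Icc.1 (h.subset_Icc F hF hv)).1) h.shadow_nonMemberSubfamily_subset
    have hregular := ((monic_X_sub_C (x m ^ 2)).pow #(𝒜.nonMemberSubfamily m)).isRegular.left
    refine hregular (hcone.trans ?_)
    rw [ihL, ihB, mul_mul_mul_comm, ← pow_add, h.card_nonMemberSubfamily_add,
      h.conjugatePolynomial_mul, conjugatePolynomial_of_le x (m := m) (by omega), mul_comp,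
      X_pow_comp, pow_add]
    ring

end ShiftedCharpoly

section Eigenvalues

variable {K : Type*} [Field K]

theorem hasEigenvaluesUpToZero_of_charpoly {ι : Type*} [Fintype ι] [DecidableEq ι]
    {M : Matrix ι ι K} {A : Multiset K} {a b : ℕ}
    (h : X ^ a * M.charpoly = X ^ b * (A.map (X - C ·)).prod) :
    HasEigenvaluesUpToZero M A := by
  classical
  have hA : (A.map (X - C ·)).prod ≠ 0 := (monic_multisetProd_X_sub_C A).ne_zero
  have hM : M.charpoly ≠ 0 := M.charpoly_monic.ne_zero
  have hX (c : ℕ) : (X : K[X]) ^ c ≠ 0 := pow_ne_zero c X_ne_zero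
  refine ⟨?_, ?_⟩
  · have hsplits : (X ^ b * (A.map (X - C ·)).prod).Splits := by
      refine (Splits.X.pow b).mul (Splits.multisetProd fun f hf => ?_)
      obtain ⟨e, -, rfl⟩ := Multiset.mem_map.1 hf
      exact Splits.X_sub_C e
    exact hsplits.of_dvd (mul_ne_zero (hX b) hA) (h ▸ dvd_mul_left _ _)
  · have hroots : a • {0} + M.charpoly.roots = b • {0} + A := by
      simpa only [roots_mul (mul_ne_zero (hX a) hM), roots_mul (mul_ne_zero (hX b) hA),
        roots_multiset_prod_X_sub_C, roots_pow, roots_X] using congrArg Polynomial.roots h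
    have hzero (c : ℕ) : (c • ({0} : Multiset K)).filter (· ≠ 0) = 0 := by
      simp [Multiset.filter_nsmul]
    have hfilter := congrArg (Multiset.filter (· ≠ 0)) hroots
    rw [Multiset.filter_add, Multiset.filter_add, hzero, hzero, zero_add, zero_add] at hfilter
    convert hfilter

theorem prod_X_sub_C_conjugateParts (x : ℕ → K) (n : ℕ) (δ : ℕ → ℕ) :
    (((conjugateParts n δ).map fun t => ∑ j ∈ Icc 1 t, x j ^ 2).map (X - C ·)).prod =
      conjugatePolynomial x 1 n δ := by
  rw [conjugateParts, Multiset.map_map, ← Multiset.coe_mapAddMonoidHom, map_sum,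
    Multiset.prod_sum, conjugatePolynomial]
  simp

theorem boundary_eq_boundaryMatrix {V : Finset ℕ} (S : Complex V) {x : ℕ → K}
    (hx : ∀ j ∈ V, x j ≠ 0) (d : ℕ) :
    boundary (fun _ j => x j) S d d =
      boundaryMatrix x (S.facesOfCard d) (S.facesOfCard (d + 1)) := by
  ext G F
  have hF : F.1 ⊆ V := S.subset_vertices F (mem_filter.1 F.2).1
  refine sum_congr rfl fun j hj => ?_
  have hface : ∏ v ∈ F.1.erase j, x v ≠ 0 :=
    prod_ne_zero_iff.2 fun v hv => hx v (hF (mem_of_mem_erase hv))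
  rw [raisedMonomial, raisedMonomial, ← mul_prod_erase F.1 x hj, mul_div_cancel_right₀ _ hface]

theorem shadow_facesOfCard_subset {V : Finset ℕ} (S : Complex V) (c : ℕ) :
    (S.facesOfCard (c + 1)).shadow ⊆ S.facesOfCard c := fun G hG => by
  obtain ⟨F, hF, j, hj, rfl⟩ := mem_shadow_iff.1 hG
  obtain ⟨hF, hcard⟩ := mem_filter.1 hF
  refine mem_filter.2 ⟨S.down_closed F hF _ (erase_subset j F), ?_⟩
  rw [card_erase_of_mem hj, hcard, Nat.add_sub_cancel]

theorem isShiftedFamily_facesOfCard {n : ℕ} {S : Complex (Icc 1 n)} (hS : S.IsShifted) (c : ℕ) :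
    IsShiftedFamily 1 n (S.facesOfCard c) where
  subset_Icc F hF := S.subset_vertices F (mem_filter.1 hF).1
  insert_mem i j G hi hij hiG hjG hG := by
    obtain ⟨hG, hcard⟩ := mem_filter.1 hG
    have hj : j ∈ Icc 1 n := S.subset_vertices _ hG (mem_insert_self j G)
    have hjn := (mem_Icc.1 hj).2
    have hiG' : i ∉ insert j G := by simp [hij.ne, hiG]
    have hmem := hS i (mem_Icc.2 (by omega)) j hj hij _ hG hiG' (mem_insert_self j G)
    rw [erase_insert hjG] at hmem
    refine mem_filter.2 ⟨hmem, ?_⟩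
    rw [card_insert_of_notMem hiG, ← hcard, card_insert_of_notMem hjG]

theorem charpoly_upDownLaplacian {n : ℕ} {S : Complex (Icc 1 n)} (hS : S.IsShifted) {x : ℕ → K}
    (hx : ∀ j ∈ Icc 1 n, x j ≠ 0) (d : ℕ) :
    X ^ #(S.facesOfCard (d + 1)) * (upDownLaplacian (fun _ j => x j) S d d).charpoly =
      X ^ (#(S.facesOfCard d) + #((S.facesOfCard (d + 1)).nonMemberSubfamily 1)) *
        conjugatePolynomial x 1 n (S.deg d) := by
  let P := boundaryMatrix x (S.facesOfCard d) (S.facesOfCard (d + 1))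
  have hswap : X ^ #(S.facesOfCard (d + 1)) * (P * Pᵀ).charpoly =
      X ^ #(S.facesOfCard d) * (Pᵀ * P).charpoly := by
    simpa only [Fintype.card_coe] using Matrix.charpoly_mul_comm' P Pᵀ
  rw [upDownLaplacian, boundary_eq_boundaryMatrix S hx, hswap,
    transpose_boundaryMatrix_mul_self x (shadow_facesOfCard_subset S d),
    (isShiftedFamily_facesOfCard hS (d + 1)).charpoly_downUpLaplacian, ← mul_assoc, ← pow_add]
  rfl

theorem coarseVar_ne_zero (k : Type*) [Field k] (j : ℕ) : coarseVar k j ≠ 0 := by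
  rw [coarseVar, Ne, IsFractionRing.to_map_eq_zero_iff]
  exact MvPolynomial.X_ne_zero j

end Eigenvalues

end ShiftedLaplacian

open ShiftedLaplacian in
theorem corollary7p9_general {K : Type*} [Field K] {n : ℕ}
    {S : ShiftedLaplacian.Complex (Finset.Icc 1 n)} (hS : S.IsShifted) (d : ℕ) {x : ℕ → K}
    (hx : ∀ j ∈ Finset.Icc 1 n, x j ≠ 0) :
    (∀ v w : ℕ, 1 ≤ v → v ≤ w → S.deg d w ≤ S.deg d v) ∧
    HasEigenvaluesUpToZero (upDownLaplacian (fun _ j => x j) S d d)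
      ((conjugateParts n (S.deg d)).map fun t => ∑ j ∈ Finset.Icc 1 t, x j ^ 2) := by
  have hcharpoly := charpoly_upDownLaplacian hS hx d
  rw [← prod_X_sub_C_conjugateParts] at hcharpoly
  exact ⟨fun _ _ hv hvw => (isShiftedFamily_facesOfCard hS (d + 1)).vertexDegree_le hv hvw,
    hasEigenvaluesUpToZero_of_charpoly hcharpoly⟩

open ShiftedLaplacian in
theorem corollary7p9 {k : Type*} [Field k] [CharZero k] (n d : ℕ)
    (S : ShiftedLaplacian.Complex (Finset.Icc 1 n)) (hdim : S.HasDim d) (hS : S.IsShifted) :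
    (∀ v w : ℕ, 1 ≤ v → v ≤ w → S.deg d w ≤ S.deg d v) ∧
    HasEigenvaluesUpToZero (coarseLaplacian k S d d)
      ((conjugateParts n (S.deg d)).map (linearForm k)) ∧
    HasEigenvaluesUpToZero (unweightedLaplacian k S d d)
      ((conjugateParts n (S.deg d)).map (fun t : ℕ => (t : k))) := by
  obtain ⟨hdeg, hcoarse⟩ := corollary7p9_general hS d fun j _ => coarseVar_ne_zero k j
  refine ⟨hdeg, hcoarse, ?_⟩
  simpa [unweightedLaplacian] using (corollary7p9_general hS d (x := fun _ => (1 : k)) (by simp)).2
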